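/- Let $(M,\rho)$ be a metric space equipped with a Borel probability measure $\mu$ that is concentrated on its support, i.e. $\mu(M\setminus\operatorname{supp}\mu)=0$ (this is automatic when $M$ is separable). For $g:M\to\mathbb R$ put $$|\nabla g(x)|=\limsup_{y\to x,\;y\neq x}\frac{|g(x)-g(y)|}{\rho(x,y)}\quad(=0\text{ if }x\text{ is isolated}),\qquad |\nabla^2 g(x)|=\big|\nabla|\nabla g|(x)\big|,$$ and call $g$ locally Lipschitz if it has a finite Lipschitz semi-norm on every ball in $M$. Let $\sigma>0$, and assume that $(M,\rho,\mu)$ satisfies a logarithmic Sobolev inequality with constant $\sigma^2$, that is, $$\int g^2\log g^2\,d\mu-\int g^2\,d\mu\,\log\int g^2\,d\mu\;\le\;2\sigma^2\int|\nabla g|^2\,d\mu$$ for every bounded $g:M\to\mathbb R$ with finite Lipschitz semi-norm (with $0\log 0=0$). Let $f:M\to\mathbb R$ be locally Lipschitz and $\mu$-integrable with $\int f\,d\mu=0$, such that $|\nabla f|$ is locally Lipschitz and $|\nabla^2 f|\le 1$ on the support of $\mu$. Then both integrals below are finite and $$\int \exp\Big\{\frac{1}{2\sigma^2}f\Big\}\,d\mu\;\le\;\exp\Big\{\frac{1}{2\sigma^2}\int|\nabla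 f|^2\,d\mu\Big\}.$$ -/

import Mathlib

open MeasureTheory Filter Topology
open scoped ENNReal NNReal

noncomputable section

namespace MetricLSI

variable {M : Type*} [MetricSpace M]

/-- The modulus of the gradient, with values in `[0, ∞]`:
`|∇f(x)| = limsup_{y → x, y ≠ x} |f x - f y| / ρ(x, y)`. At an isolated point the limsup is over
the trivial filter and equals `0`. -/
def eGradModulus (f : M → ℝ) (x : M) : ℝ≥0∞ :=
  limsup (fun y => ENNReal.ofReal (|f x - f y| / dist x y)) (𝓝[≠] x)

/-- The modulus of the gradient as a real number. It is only used for locally Lipschitz functions,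
for which `eGradModulus f x` is finite at every point. -/
def gradModulus (f : M → ℝ) (x : M) : ℝ := (eGradModulus f x).toReal

/-- The second order modulus of the gradients, `|∇²f| = |∇ |∇f| |`. -/
def secondOrderModulus (f : M → ℝ) (x : M) : ℝ≥0∞ := eGradModulus (gradModulus f) x

/-- Locally Lipschitz: finite Lipschitz semi-norm on every ball (of arbitrary radius). -/
def LocLip (f : M → ℝ) : Prop :=
  ∀ (x : M) (r : ℝ), ∃ K : ℝ≥0, LipschitzOnWith K f (Metric.ball x r)

/-- The entropy functional `Ent_μ(u) = ∫ u log u dμ - ∫ u dμ · log ∫ u dμ`, with `0 log 0 = 0`.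
It is only used for bounded non-negative measurable `u` and a probability measure `μ`. -/
def entropy [MeasurableSpace M] (μ : Measure M) (u : M → ℝ) : ℝ :=
  (∫ x, u x * Real.log (u x) ∂μ) - (∫ x, u x ∂μ) * Real.log (∫ x, u x ∂μ)

/-- `(M, ρ, μ)` satisfies a logarithmic Sobolev inequality with constant `c` (`= σ²`):
`Ent_μ(g²) ≤ 2 c ∫ |∇g|² dμ` for every bounded `g` with finite Lipschitz semi-norm. -/
def LogSobolev [MeasurableSpace M] (μ : Measure M) (c : ℝ) : Prop :=
  ∀ g : M → ℝ, (∃ C : ℝ, ∀ x, |g x| ≤ C) → (∃ K : ℝ≥0, LipschitzWith K g) →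
    entropy μ (fun x => g x ^ 2) ≤ 2 * c * ∫ x, gradModulus g x ^ 2 ∂μ

end MetricLSI

end

/-!
The logarithmic Sobolev inequality with constant `c = σ²` is applied twice.

* If `g` is bounded and `|∇g| ≤ H`, then `∫ e^g ≤ e^{∫ g} ∫ e^{c H²}`
  (`LogSobolev.integral_exp_le`). The inequality for `e^{t g / 2}` together with the variational
  formula for the entropy (`integral_mul_exp_le_entropy`) bounds the derivative of
  `t ↦ log (∫ e^{t g}) / t` on `(0, 1]` by `log ∫ e^{c H²}`; at `0` this function tends to `∫ g`.
* If `u ≥ 0` and `|∇u| ≤ 1`, then `∫ e^{u² / (4c)} ≤ e^{∫ u² / (2c)}`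
  (`LogSobolev.integral_exp_sq_le`). For bounded `u`, the inequality for `e^{t u² / 2}` shows that
  `t ↦ (1 - 2 c t) log (∫ e^{t u²}) / t` is nonincreasing; at `0` it tends to `∫ u²`, and
  `t = 1 / (4c)` gives the claim. That `∫ u²` is finite for unbounded `u` follows from the first
  statement with `H = 1` (`LogSobolev.integrable_sq`).

With `g = f / (2c)` and `H = |∇f| / (2c)` one has `c H² = |∇f|² / (4c)`, so the second statement for
`u = |∇f|` bounds the right side of the first. Both differential inequalities are integrated in
`cgf_le_of_differential_inequality`.

The hypothesis concerns bounded Lipschitz functions only. Bounded locally Lipschitz functions are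
reached with cutoffs (`LogSobolev.entropy_sq_le`), unbounded ones by truncation and Fatou's lemma
(`integrable_and_integral_le_of_tendsto`). Gradients are handled through the pointwise upper bound
`HasGradBound`, so that neither exact formulas for, nor measurability of, the gradient moduli of the
auxiliary functions are needed.
-/

namespace MetricLSI

/-! ### Auxiliary facts on integrals and moment generating functions -/

section Integral

variable {α : Type*} [MeasurableSpace α] {μ : Measure α}

lemma integrable_and_integral_le_of_tendsto {F : ℕ → α → ℝ} {G : α → ℝ} {B : ℕ → ℝ} {b : ℝ}
    (hF : ∀ n, Integrable (F n) μ) (hF0 : ∀ n x, 0 ≤ F n x)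
    (hlim : ∀ x, Tendsto (fun n => F n x) atTop (𝓝 (G x)))
    (hB : ∀ n, ∫ x, F n x ∂μ ≤ B n) (hb : Tendsto B atTop (𝓝 b)) :
    Integrable G μ ∧ ∫ x, G x ∂μ ≤ b := by
  have hG0 : ∀ x, 0 ≤ G x := fun x => ge_of_tendsto' (hlim x) fun n => hF0 n x
  have hGm : AEStronglyMeasurable G μ :=
    aestronglyMeasurable_of_tendsto_ae atTop (fun n => (hF n).aestronglyMeasurable)
      (Eventually.of_forall hlim)
  have hb0 : 0 ≤ b := ge_of_tendsto' hb fun n => (integral_nonneg (hF0 n)).trans (hB n)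
  have key : ∫⁻ x, ENNReal.ofReal (G x) ∂μ ≤ ENNReal.ofReal b := by
    calc ∫⁻ x, ENNReal.ofReal (G x) ∂μ
        = ∫⁻ x, liminf (fun n => ENNReal.ofReal (F n x)) atTop ∂μ :=
          lintegral_congr fun x => ((ENNReal.tendsto_ofReal (hlim x)).liminf_eq).symm
      _ ≤ liminf (fun n => ∫⁻ x, ENNReal.ofReal (F n x) ∂μ) atTop :=
          lintegral_liminf_le' fun n => (hF n).aestronglyMeasurable.aemeasurable.ennreal_ofReal
      _ ≤ liminf (fun n => ENNReal.ofReal (B n)) atTop := by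
          refine liminf_le_liminf (Eventually.of_forall fun n => ?_)
          rw [← ofReal_integral_eq_lintegral_ofReal (hF n) (Eventually.of_forall (hF0 n))]
          exact ENNReal.ofReal_le_ofReal (hB n)
      _ = ENNReal.ofReal b := (ENNReal.tendsto_ofReal hb).liminf_eq
  refine ⟨⟨hGm, ?_⟩, ?_⟩
  · rw [hasFiniteIntegral_iff_ofReal (Eventually.of_forall hG0)]
    exact key.trans_lt ENNReal.ofReal_lt_top
  · rw [integral_eq_lintegral_of_nonneg_ae (Eventually.of_forall hG0) hGm]
    exact ENNReal.toReal_le_of_le_ofReal hb0 key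

lemma integrable_comp_of_bounded [IsFiniteMeasure μ] {g : α → ℝ} {C : ℝ} (hg : Measurable g)
    (hC : ∀ x, |g x| ≤ C) {Φ : ℝ → ℝ} (hΦ : Continuous Φ) :
    Integrable (fun x => Φ (g x)) μ := by
  obtain ⟨D, hD⟩ := (isCompact_Icc (a := -C) (b := C)).exists_bound_of_continuousOn hΦ.continuousOn
  exact Integrable.of_bound (hΦ.measurable.comp hg).aestronglyMeasurable D
    (Eventually.of_forall fun x => hD _ (abs_le.1 (hC x)))

lemma tendsto_integral_comp_of_bounded [IsFiniteMeasure μ] {g : ℕ → α → ℝ} {g' : α → ℝ} {C : ℝ}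
    (hg : ∀ n, Measurable (g n)) (hC : ∀ n x, |g n x| ≤ C)
    (hlim : ∀ x, Tendsto (fun n => g n x) atTop (𝓝 (g' x))) {Φ : ℝ → ℝ} (hΦ : Continuous Φ) :
    Tendsto (fun n => ∫ x, Φ (g n x) ∂μ) atTop (𝓝 (∫ x, Φ (g' x) ∂μ)) := by
  obtain ⟨D, hD⟩ := (isCompact_Icc (a := -C) (b := C)).exists_bound_of_continuousOn hΦ.continuousOn
  exact tendsto_integral_of_dominated_convergence (fun _ => D)
    (fun n => (hΦ.measurable.comp (hg n)).aestronglyMeasurable) (integrable_const _)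
    (fun n => Eventually.of_forall fun x => hD _ (abs_le.1 (hC n x)))
    (Eventually.of_forall fun x => (hΦ.tendsto _).comp (hlim x))

/-- Half of the variational formula `Ent(e^g) = sup {∫ h e^g : ∫ e^h ≤ 1}` for the entropy. -/
lemma integral_mul_exp_le_entropy [IsProbabilityMeasure μ] {g h : α → ℝ} {C : ℝ}
    (hg : Measurable g) (hC : ∀ x, |g x| ≤ C)
    (hh : Integrable (fun x => h x * Real.exp (g x)) μ)
    (hexp : Integrable (fun x => Real.exp (h x)) μ) :
    ∫ x, h x * Real.exp (g x) ∂μ - (∫ x, Real.exp (g x) ∂μ) * Real.log (∫ x, Real.exp (h x) ∂μ)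
      ≤ ∫ x, g x * Real.exp (g x) ∂μ
        - (∫ x, Real.exp (g x) ∂μ) * Real.log (∫ x, Real.exp (g x) ∂μ) := by
  have hge : Integrable (fun x => Real.exp (g x)) μ :=
    integrable_comp_of_bounded hg hC Real.continuous_exp
  have hgge : Integrable (fun x => g x * Real.exp (g x)) μ :=
    integrable_comp_of_bounded hg hC (continuous_id.mul Real.continuous_exp)
  set Z := ∫ x, Real.exp (g x) ∂μ with hZ
  set β := ∫ x, Real.exp (h x) ∂μ with hβ
  have hZ0 : 0 < Z := integral_exp_pos hge
  have hβ0 : 0 < β := integral_exp_pos hexp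
  -- Integrate `s + 1 ≤ e^s` at `s = (h - log β) - (g - log Z)`, multiplied by `e^g`.
  have hpt : ∀ x, h x * Real.exp (g x)
      ≤ g x * Real.exp (g x) + (Real.log β - Real.log Z - 1) * Real.exp (g x)
        + Z / β * Real.exp (h x) := by
    intro x
    have h1 := Real.add_one_le_exp ((h x - Real.log β) - (g x - Real.log Z))
    have h2 : Real.exp ((h x - Real.log β) - (g x - Real.log Z)) * Real.exp (g x)
        = Z / β * Real.exp (h x) := by
      rw [Real.exp_sub, Real.exp_sub, Real.exp_sub, Real.exp_log hβ0, Real.exp_log hZ0]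
      have := Real.exp_pos (g x)
      field_simp
    nlinarith [mul_le_mul_of_nonneg_right h1 (Real.exp_pos (g x)).le]
  have := integral_mono hh ((hgge.add (hge.const_mul _)).add (hexp.const_mul (Z / β))) hpt
  simp only [Pi.add_apply] at this
  rw [integral_add (f := fun x => g x * Real.exp (g x)
        + (Real.log β - Real.log Z - 1) * Real.exp (g x)) (hgge.add (hge.const_mul _))
      (hexp.const_mul _), integral_add hgge (hge.const_mul _), integral_const_mul,
      integral_const_mul, ← hZ, ← hβ, div_mul_cancel₀ _ hβ0.ne'] at this
  linarith

end Integral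

section Cgf

variable {α : Type*} [MeasurableSpace α] {μ : Measure α} [IsProbabilityMeasure μ]
  {X : α → ℝ} {C : ℝ}

lemma hasDerivAt_cgf_of_bounded (hX : Measurable X) (hC : ∀ x, |X x| ≤ C) (t : ℝ) :
    HasDerivAt (ProbabilityTheory.cgf X μ)
      ((∫ x, X x * Real.exp (t * X x) ∂μ) / ProbabilityTheory.mgf X μ t) t := by
  have hset : ProbabilityTheory.integrableExpSet X μ = Set.univ := by
    refine Set.eq_univ_of_forall fun s => ?_
    exact integrable_comp_of_bounded hX hC
      (Real.continuous_exp.comp (continuous_const.mul continuous_id))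
  have ht : t ∈ interior (ProbabilityTheory.integrableExpSet X μ) := by simp [hset]
  rw [← ProbabilityTheory.deriv_cgf ht]
  exact (ProbabilityTheory.analyticAt_cgf ht).differentiableAt.hasDerivAt

lemma tendsto_cgf_div (hX : Measurable X) (hC : ∀ x, |X x| ≤ C) :
    Tendsto (fun t => ProbabilityTheory.cgf X μ t / t) (𝓝[>] 0) (𝓝 (∫ x, X x ∂μ)) := by
  have h := hasDerivAt_cgf_of_bounded (μ := μ) hX hC 0
  simp only [zero_mul, Real.exp_zero, mul_one, ProbabilityTheory.mgf_zero, div_one] at h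
  refine ((hasDerivAt_iff_tendsto_slope.1 h).mono_left
    (nhdsWithin_mono _ fun x hx => ne_of_gt hx)).congr fun t => ?_
  simp [slope, div_eq_inv_mul]

/-- If the logarithmic moment generating function `K` of `X` satisfies the differential inequality
`t (1 - a t) K'(t) - K(t) ≤ b t²` on `(0, T]`, then `(1 - a t) K(t) / t - b t` is nonincreasing
there, and its limit at `0` is the mean of `X`. -/
lemma cgf_le_of_differential_inequality (hX : Measurable X) (hC : ∀ x, |X x| ≤ C) {a b T : ℝ}
    (hT : 0 < T)
    (h : ∀ t, 0 < t → t ≤ T →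
      t * (1 - a * t) * ((∫ x, X x * Real.exp (t * X x) ∂μ) / ProbabilityTheory.mgf X μ t)
        - ProbabilityTheory.cgf X μ t ≤ b * t ^ 2) :
    (1 - a * T) * (ProbabilityTheory.cgf X μ T / T) - b * T ≤ ∫ x, X x ∂μ := by
  set K := ProbabilityTheory.cgf X μ with hK
  set G : ℝ → ℝ := fun t => (1 - a * t) * (K t / t) - b * t with hG
  have hder : ∀ t, 0 < t → HasDerivAt G
      ((t * (1 - a * t) * ((∫ x, X x * Real.exp (t * X x) ∂μ) / ProbabilityTheory.mgf X μ t)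
        - K t - b * t ^ 2) / t ^ 2) t := by
    intro t ht
    have h1 := hasDerivAt_cgf_of_bounded (μ := μ) hX hC t
    have h2 := (((hasDerivAt_id t).const_mul a).const_sub 1).mul (h1.div (hasDerivAt_id t) ht.ne')
    have h3 : HasDerivAt G _ t := h2.sub ((hasDerivAt_id t).const_mul b)
    refine h3.congr_deriv ?_
    simp only [id, Pi.div_apply]
    field_simp
    ring
  have hanti : AntitoneOn G (Set.Ioc 0 T) := by
    refine antitoneOn_of_deriv_nonpos (convex_Ioc 0 T)
      (fun t ht => (hder t ht.1).continuousAt.continuousWithinAt)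
      (fun t ht => (hder t (interior_subset ht).1).differentiableAt.differentiableWithinAt) ?_
    intro t ht
    have ht' := interior_subset ht
    rw [(hder t ht'.1).deriv]
    exact div_nonpos_of_nonpos_of_nonneg (by linarith [h t ht'.1 ht'.2]) (sq_nonneg t)
  have hlim : Tendsto G (𝓝[>] 0) (𝓝 (∫ x, X x ∂μ)) := by
    have h1 : Tendsto (fun t : ℝ => 1 - a * t) (𝓝[>] 0) (𝓝 1) := by
      have : Continuous fun t : ℝ => 1 - a * t := by fun_prop
      simpa using (this.tendsto 0).mono_left nhdsWithin_le_nhds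
    have h2 : Tendsto (fun t : ℝ => b * t) (𝓝[>] 0) (𝓝 0) := by
      have : Continuous fun t : ℝ => b * t := by fun_prop
      simpa using (this.tendsto 0).mono_left nhdsWithin_le_nhds
    simpa using (h1.mul (tendsto_cgf_div hX hC)).sub h2
  refine ge_of_tendsto hlim ?_
  filter_upwards [Ioc_mem_nhdsGT hT] with t ht
  exact hanti ht ⟨hT, le_rfl⟩ ht.2

end Cgf

/-! ### Calculus of the gradient modulus -/

section Gradient

variable {M : Type*} [MetricSpace M]

/-- `L` bounds the gradient modulus of `g` at `x`: for each `L' > L`, the difference quotients of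
`g` at `x` are eventually at most `L'`. For `L ≥ 0` this is equivalent to
`eGradModulus g x ≤ ENNReal.ofReal L`. -/
def HasGradBound (g : M → ℝ) (x : M) (L : ℝ) : Prop :=
  ∀ L', L < L' → ∀ᶠ y in 𝓝 x, |g x - g y| ≤ L' * dist x y

lemma HasGradBound.eGradModulus_le {g : M → ℝ} {x : M} {L : ℝ} (hL : 0 ≤ L)
    (h : HasGradBound g x L) : eGradModulus g x ≤ ENNReal.ofReal L := by
  have h1 : ∀ L', L < L' → eGradModulus g x ≤ ENNReal.ofReal L' := by
    intro L' hL'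
    refine limsup_le_of_le (by isBoundedDefault) ?_
    filter_upwards [(h L' hL').filter_mono nhdsWithin_le_nhds] with y hy
    exact ENNReal.ofReal_le_ofReal (div_le_of_le_mul₀ dist_nonneg (hL.trans hL'.le) hy)
  have h2 : Tendsto ENNReal.ofReal (𝓝[>] L) (𝓝 (ENNReal.ofReal L)) :=
    (ENNReal.continuous_ofReal.tendsto L).mono_left nhdsWithin_le_nhds
  refine ge_of_tendsto h2 ?_
  filter_upwards [self_mem_nhdsWithin] with L' hL' using h1 L' hL'

lemma HasGradBound.gradModulus_le {g : M → ℝ} {x : M} {L : ℝ} (hL : 0 ≤ L)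
    (h : HasGradBound g x L) : gradModulus g x ≤ L :=
  ENNReal.toReal_le_of_le_ofReal hL (h.eGradModulus_le hL)

lemma hasGradBound_of_eGradModulus_le {g : M → ℝ} {x : M} {L : ℝ} (hL : 0 ≤ L)
    (h : eGradModulus g x ≤ ENNReal.ofReal L) : HasGradBound g x L := by
  intro L' hL'
  have h1 : eGradModulus g x < ENNReal.ofReal L' :=
    h.trans_lt ((ENNReal.ofReal_lt_ofReal_iff (hL.trans_lt hL')).2 hL')
  have h2 := eventually_nhdsWithin_iff.1 (eventually_lt_of_limsup_lt h1)
  filter_upwards [h2] with y hy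
  rcases eq_or_ne y x with rfl | hne
  · simp
  · have h3 := (ENNReal.ofReal_lt_ofReal_iff (hL.trans_lt hL')).1 (hy hne)
    exact ((div_lt_iff₀ (dist_pos.2 hne.symm)).1 h3).le

lemma HasGradBound.continuousAt {g : M → ℝ} {x : M} {L : ℝ} (h : HasGradBound g x L) :
    ContinuousAt g x := by
  rw [ContinuousAt, tendsto_iff_dist_tendsto_zero]
  have h1 : Tendsto (fun y => (L + 1) * dist x y) (𝓝 x) (𝓝 0) := by
    have : Continuous fun y => (L + 1) * dist x y := by fun_prop
    simpa using this.tendsto x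
  refine squeeze_zero' (Eventually.of_forall fun _ => dist_nonneg) ?_ h1
  filter_upwards [h (L + 1) (by linarith)] with y hy
  rwa [dist_comm, Real.dist_eq]

/-- Chain rule for the gradient modulus. -/
lemma HasGradBound.comp {g : M → ℝ} {x : M} {L d : ℝ} {Φ : ℝ → ℝ} (h : HasGradBound g x L)
    (hΦ : HasDerivAt Φ d (g x)) : HasGradBound (fun y => Φ (g y)) x (|d| * L) := by
  intro L' hL'
  obtain ⟨ε, hε, hεL⟩ : ∃ ε > 0, (|d| + ε) * (L + ε) ≤ L' := by
    have hc : Tendsto (fun ε : ℝ => (|d| + ε) * (L + ε)) (𝓝[>] 0) (𝓝 (|d| * L)) := by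
      have : Continuous fun ε : ℝ => (|d| + ε) * (L + ε) := by fun_prop
      simpa using (this.tendsto 0).mono_left nhdsWithin_le_nhds
    obtain ⟨ε, h1, h2⟩ := ((hc.eventually_lt_const hL').and self_mem_nhdsWithin).exists
    exact ⟨ε, h2, h1.le⟩
  have h1 := h.continuousAt.eventually ((hasDerivAt_iff_isLittleO.1 hΦ).bound hε)
  filter_upwards [h1, h (L + ε) (by linarith)] with y hy1 hy2
  simp only [Real.norm_eq_abs, smul_eq_mul] at hy1
  have h3 : |Φ (g y) - Φ (g x)| ≤ (|d| + ε) * |g y - g x| := by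
    have := abs_add_le (Φ (g y) - Φ (g x) - (g y - g x) * d) ((g y - g x) * d)
    rw [sub_add_cancel, abs_mul] at this
    nlinarith
  calc |Φ (g x) - Φ (g y)| ≤ (|d| + ε) * |g x - g y| := by
        rwa [abs_sub_comm, abs_sub_comm (g x)]
    _ ≤ (|d| + ε) * ((L + ε) * dist x y) :=
        mul_le_mul_of_nonneg_left hy2 (by positivity)
    _ ≤ L' * dist x y := by
        rw [← mul_assoc]; exact mul_le_mul_of_nonneg_right hεL dist_nonneg

lemma HasGradBound.comp_lipschitz {g : M → ℝ} {x : M} {L : ℝ} {Φ : ℝ → ℝ}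
    (h : HasGradBound g x L) (hΦ : LipschitzWith 1 Φ) : HasGradBound (fun y => Φ (g y)) x L := by
  intro L' hL'
  filter_upwards [h L' hL'] with y hy
  have := hΦ.dist_le_mul (g x) (g y)
  simp only [Real.dist_eq, NNReal.coe_one, one_mul] at this
  exact this.trans hy

lemma HasGradBound.const_mul {g : M → ℝ} {x : M} {L : ℝ} (h : HasGradBound g x L)
    (t : ℝ) : HasGradBound (fun y => t * g y) x (|t| * L) :=
  h.comp (Φ := fun s => t * s) (by simpa using (hasDerivAt_id (g x)).const_mul t)

lemma LocLip.continuous {g : M → ℝ} (hg : LocLip g) : Continuous g := by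
  refine continuous_iff_continuousAt.2 fun x => ?_
  obtain ⟨K, hK⟩ := hg x 1
  exact hK.continuousOn.continuousAt (Metric.ball_mem_nhds x one_pos)

lemma LocLip.hasGradBound {g : M → ℝ} (hg : LocLip g) (x : M) :
    HasGradBound g x (gradModulus g x) := by
  obtain ⟨K, hK⟩ := hg x 1
  have h1 : HasGradBound g x K := by
    intro L' hL'
    filter_upwards [Metric.ball_mem_nhds x one_pos] with y hy
    have := hK.dist_le_mul x (Metric.mem_ball_self one_pos) y hy
    rw [Real.dist_eq] at this
    exact this.trans (mul_le_mul_of_nonneg_right hL'.le dist_nonneg)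
  have h2 : eGradModulus g x ≠ ∞ :=
    ((h1.eGradModulus_le K.2).trans_lt ENNReal.ofReal_lt_top).ne
  exact hasGradBound_of_eGradModulus_le ENNReal.toReal_nonneg (ENNReal.ofReal_toReal h2).ge

lemma LocLip.comp_lipschitz {g : M → ℝ} (hg : LocLip g) {Φ : ℝ → ℝ} {K : ℝ≥0}
    (hΦ : LipschitzWith K Φ) : LocLip fun x => Φ (g x) := fun x r => by
  obtain ⟨K', hK'⟩ := hg x r
  exact ⟨K * K', hΦ.comp_lipschitzOnWith hK'⟩

lemma LocLip.const_mul {g : M → ℝ} (hg : LocLip g) (t : ℝ) : LocLip fun x => t * g x :=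
  hg.comp_lipschitz (Φ := fun s => t * s) (lipschitzWith_smul t)

lemma LocLip.comp_contDiff {g : M → ℝ} (hg : LocLip g) {C : ℝ} (hC : ∀ x, |g x| ≤ C) {Φ : ℝ → ℝ}
    (hΦ : ContDiff ℝ 1 Φ) : LocLip fun x => Φ (g x) := fun x r => by
  obtain ⟨K', hK'⟩ := hg x r
  obtain ⟨K, hK⟩ := hΦ.locallyLipschitz.locallyLipschitzOn.exists_lipschitzOnWith_of_compact
    (isCompact_Icc (a := -C) (b := C))
  exact ⟨K * K', hK.comp hK' fun y _ => abs_le.1 (hC y)⟩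

end Gradient

/-! ### Truncation and cutoff -/

/-- Truncation of the real line to `[-n, n]`. -/
def trunc (n : ℕ) (s : ℝ) : ℝ := max (-n) (min n s)

lemma lipschitzWith_trunc (n : ℕ) : LipschitzWith 1 (trunc n) :=
  (LipschitzWith.id.const_min _).const_max _

lemma abs_trunc_le_nat (n : ℕ) (s : ℝ) : |trunc n s| ≤ n := by
  have : (0 : ℝ) ≤ n := n.cast_nonneg
  exact abs_le.2 ⟨le_max_left _ _, max_le (by linarith) (min_le_left _ _)⟩

lemma trunc_eq_self {n : ℕ} {s : ℝ} (h : |s| ≤ n) : trunc n s = s := by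
  rw [trunc, min_eq_right (abs_le.1 h).2, max_eq_right (abs_le.1 h).1]

lemma abs_trunc_le (n : ℕ) (s : ℝ) : |trunc n s| ≤ |s| := by
  rcases le_total |s| n with h | h
  · rw [trunc_eq_self h]
  · exact (abs_trunc_le_nat n s).trans h

lemma tendsto_trunc (s : ℝ) : Tendsto (fun n => trunc n s) atTop (𝓝 s) := by
  refine tendsto_const_nhds.congr' ?_
  filter_upwards [eventually_ge_atTop ⌈|s|⌉₊] with n hn
  exact (trunc_eq_self ((Nat.le_ceil _).trans (by exact_mod_cast hn))).symm

section Cutoff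

variable {M : Type*} [MetricSpace M]

/-- The cutoff function of slope `a > 0` around `x₀`, equal to `1` on the ball of radius `1 / a`
and to `0` outside the ball of radius `2 / a`. -/
def cutoff (x₀ : M) (a : ℝ) (x : M) : ℝ := max 0 (min 1 (2 - a * dist x x₀))

variable {x₀ : M} {a : ℝ}

lemma cutoff_nonneg (x : M) : 0 ≤ cutoff x₀ a x := le_max_left _ _

lemma cutoff_le_one (x : M) : cutoff x₀ a x ≤ 1 := max_le zero_le_one (min_le_left _ _)

lemma abs_cutoff_sub_le (ha : 0 ≤ a) (x y : M) :
    |cutoff x₀ a x - cutoff x₀ a y| ≤ a * dist x y := by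
  have h1 : LipschitzWith 1 fun s : ℝ => max 0 (min 1 s) :=
    (LipschitzWith.id.const_min _).const_max _
  have h2 := h1.dist_le_mul (2 - a * dist x x₀) (2 - a * dist y x₀)
  rw [NNReal.coe_one, one_mul, Real.dist_eq, Real.dist_eq] at h2
  refine h2.trans ?_
  rw [show 2 - a * dist x x₀ - (2 - a * dist y x₀) = a * (dist y x₀ - dist x x₀) by ring, abs_mul,
    abs_of_nonneg ha]
  refine mul_le_mul_of_nonneg_left ?_ ha
  rw [dist_comm x y]
  exact abs_dist_sub_le y x x₀

lemma cutoff_eq_zero (ha : 0 < a) {x : M} (hx : x ∉ Metric.ball x₀ (2 / a)) :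
    cutoff x₀ a x = 0 := by
  have h1 : 2 ≤ a * dist x x₀ := by
    have := not_lt.1 (Metric.mem_ball.not.1 hx)
    rwa [div_le_iff₀' ha] at this
  exact max_eq_left ((min_le_right _ _).trans (by linarith))

lemma tendsto_cutoff (x : M) :
    Tendsto (fun n : ℕ => cutoff x₀ (1 / ((n : ℝ) + 1)) x) atTop (𝓝 1) := by
  have h : Continuous fun s : ℝ => max 0 (min 1 (2 - s * dist x x₀)) := by fun_prop
  have h2 := (h.tendsto 0).comp (tendsto_one_div_add_atTop_nhds_zero_nat (𝕜 := ℝ))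
  have h3 : max 0 (min 1 (2 - (0 : ℝ) * dist x x₀)) = 1 := by norm_num
  rw [h3] at h2
  exact h2

variable {g : M → ℝ} {C : ℝ}

lemma abs_mul_cutoff_sub_le (hC : ∀ x, |g x| ≤ C) (ha : 0 ≤ a) (x y : M) :
    |g x * cutoff x₀ a x - g y * cutoff x₀ a y| ≤ |g x - g y| * cutoff x₀ a y
      + C * a * dist x y := by
  have h1 : g x * cutoff x₀ a x - g y * cutoff x₀ a y
      = (g x - g y) * cutoff x₀ a y + g x * (cutoff x₀ a x - cutoff x₀ a y) := by ring
  have hC0 : 0 ≤ C := (abs_nonneg _).trans (hC x)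
  rw [h1, mul_assoc]
  refine (abs_add_le _ _).trans (add_le_add ?_ ?_)
  · rw [abs_mul, abs_of_nonneg (cutoff_nonneg y)]
  · rw [abs_mul]
    exact mul_le_mul (hC x) (abs_cutoff_sub_le ha x y) (abs_nonneg _) hC0

lemma HasGradBound.mul_cutoff (hC : ∀ x, |g x| ≤ C) (ha : 0 ≤ a) {x : M} {L : ℝ}
    (h : HasGradBound g x L) : HasGradBound (fun y => g y * cutoff x₀ a y) x (L + C * a) := by
  intro L' hL'
  filter_upwards [h (L' - C * a) (by linarith)] with y hy
  have h1 := abs_mul_cutoff_sub_le (x₀ := x₀) hC ha x y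
  have h2 : |g x - g y| * cutoff x₀ a y ≤ |g x - g y| :=
    mul_le_of_le_one_right (abs_nonneg _) (cutoff_le_one y)
  linarith

lemma LocLip.exists_lipschitzWith_mul_cutoff (hg : LocLip g) (hC : ∀ x, |g x| ≤ C) (ha : 0 < a) :
    ∃ K : ℝ≥0, LipschitzWith K fun x => g x * cutoff x₀ a x := by
  obtain ⟨K, hK⟩ := hg x₀ (2 / a)
  have hC0 : 0 ≤ C := (abs_nonneg _).trans (hC x₀)
  refine ⟨K + ⟨C * a, by positivity⟩, LipschitzWith.of_dist_le_mul ?_⟩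
  suffices H : ∀ x y, (x ∈ Metric.ball x₀ (2 / a) ∨ y ∉ Metric.ball x₀ (2 / a)) →
      |g x * cutoff x₀ a x - g y * cutoff x₀ a y| ≤ (K + C * a) * dist x y by
    intro x y
    rw [Real.dist_eq]
    by_cases hx : x ∈ Metric.ball x₀ (2 / a)
    · exact H x y (Or.inl hx)
    · rw [abs_sub_comm, dist_comm]
      exact H y x (Or.inr hx)
  intro x y hxy
  have h1 := abs_mul_cutoff_sub_le (x₀ := x₀) hC ha.le x y
  have h2 : |g x - g y| * cutoff x₀ a y ≤ K * dist x y := by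
    by_cases hy : y ∈ Metric.ball x₀ (2 / a)
    · have h3 := hK.dist_le_mul x (hxy.resolve_right (not_not.2 hy)) y hy
      rw [Real.dist_eq] at h3
      exact (mul_le_of_le_one_right (abs_nonneg _) (cutoff_le_one y)).trans h3
    · rw [cutoff_eq_zero ha hy, mul_zero]
      positivity
  linarith

end Cutoff

/-! ### The logarithmic Sobolev inequality for bounded locally Lipschitz functions -/

section LogSobolev

variable {M : Type*} [MetricSpace M] [MeasurableSpace M] [BorelSpace M]
  {μ : Measure M} [IsProbabilityMeasure μ] {c : ℝ} {g H : M → ℝ} {C : ℝ}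

/-- The inequality passes from Lipschitz to bounded locally Lipschitz functions: multiply by cutoffs
of slope `1 / (n + 1)`, which increases the gradient by at most `C / (n + 1)`. -/
lemma LogSobolev.entropy_sq_le (hLSI : LogSobolev μ c) (hc : 0 ≤ c) (hg : LocLip g)
    (hC : ∀ x, |g x| ≤ C) (hH0 : ∀ x, 0 ≤ H x) (hHm : AEStronglyMeasurable H μ)
    (hH2 : Integrable (fun x => H x ^ 2) μ) (hgH : ∀ᵐ x ∂μ, HasGradBound g x (H x)) :
    entropy μ (fun x => g x ^ 2) ≤ 2 * c * ∫ x, H x ^ 2 ∂μ := by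
  obtain ⟨x₀⟩ : Nonempty M := nonempty_of_isProbabilityMeasure μ
  have hC0 : 0 ≤ C := (abs_nonneg _).trans (hC x₀)
  have hH1 : Integrable H μ := ((memLp_two_iff_integrable_sq hHm).2 hH2).integrable one_le_two
  set a : ℕ → ℝ := fun n => 1 / ((n : ℝ) + 1) with ha_def
  have ha : ∀ n, 0 < a n := fun n => by positivity
  have ha0 : Tendsto a atTop (𝓝 0) := tendsto_one_div_add_atTop_nhds_zero_nat
  set G : ℕ → M → ℝ := fun n x => g x * cutoff x₀ (a n) x with hG
  have hGC : ∀ n x, |G n x| ≤ C := fun n x => by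
    rw [hG, abs_mul, abs_of_nonneg (cutoff_nonneg x)]
    exact (mul_le_of_le_one_right (abs_nonneg _) (cutoff_le_one x)).trans (hC x)
  have hlip : ∀ n, ∃ K : ℝ≥0, LipschitzWith K (G n) :=
    fun n => hg.exists_lipschitzWith_mul_cutoff hC (ha n)
  have hGm : ∀ n, Measurable (G n) := fun n => (hlip n).choose_spec.continuous.measurable
  have hGlim : ∀ x, Tendsto (fun n => G n x) atTop (𝓝 (g x)) := fun x => by
    simpa only [mul_one] using (tendsto_cutoff (x₀ := x₀) x).const_mul (g x)
  have hle : ∀ n, entropy μ (fun x => G n x ^ 2)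
      ≤ 2 * c * (∫ x, H x ^ 2 ∂μ + 2 * (C * a n) * ∫ x, H x ∂μ + (C * a n) ^ 2) := by
    intro n
    refine (hLSI (G n) ⟨C, hGC n⟩ (hlip n)).trans ?_
    refine mul_le_mul_of_nonneg_left ?_ (by positivity)
    have hint : Integrable (fun x => H x ^ 2 + 2 * (C * a n) * H x) μ :=
      hH2.add (hH1.const_mul _)
    calc ∫ x, gradModulus (G n) x ^ 2 ∂μ
        ≤ ∫ x, (H x ^ 2 + 2 * (C * a n) * H x + (C * a n) ^ 2) ∂μ := by
          refine integral_mono_of_nonneg (Eventually.of_forall fun x => sq_nonneg _)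
            (hint.add (integrable_const _)) ?_
          filter_upwards [hgH] with x hx
          have h0 : 0 ≤ H x + C * a n := add_nonneg (hH0 x) (mul_nonneg hC0 (ha n).le)
          have h1 : gradModulus (G n) x ≤ H x + C * a n :=
            (hx.mul_cutoff (x₀ := x₀) hC (ha n).le).gradModulus_le h0
          have h2 : 0 ≤ gradModulus (G n) x := ENNReal.toReal_nonneg
          nlinarith
      _ = _ := by
          rw [integral_add hint (integrable_const _), integral_add hH2 (hH1.const_mul _),
            integral_const_mul]
          simp
  have hent : Tendsto (fun n => entropy μ (fun x => G n x ^ 2)) atTop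
      (𝓝 (entropy μ (fun x => g x ^ 2))) := by
    have h1 := tendsto_integral_comp_of_bounded (μ := μ) hGm hGC hGlim (continuous_pow 2)
    have h2 := tendsto_integral_comp_of_bounded (μ := μ) hGm hGC hGlim
      (Real.continuous_mul_log.comp (continuous_pow 2))
    exact h2.sub ((Real.continuous_mul_log.tendsto _).comp h1)
  have hrhs : Tendsto
      (fun n => 2 * c * (∫ x, H x ^ 2 ∂μ + 2 * (C * a n) * ∫ x, H x ∂μ + (C * a n) ^ 2)) atTop
      (𝓝 (2 * c * ∫ x, H x ^ 2 ∂μ)) := by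
    have h : Continuous fun s : ℝ =>
      2 * c * (∫ x, H x ^ 2 ∂μ + 2 * (C * s) * ∫ x, H x ∂μ + (C * s) ^ 2) := by fun_prop
    simpa [Function.comp_def] using (h.tendsto 0).comp ha0
  exact le_of_tendsto_of_tendsto' hent hrhs hle

/-- The logarithmic Sobolev inequality for `e^{g / 2}`. -/
lemma LogSobolev.entropy_exp_le (hLSI : LogSobolev μ c) (hc : 0 ≤ c) (hg : LocLip g)
    (hC : ∀ x, |g x| ≤ C) (hH0 : ∀ x, 0 ≤ H x) (hHm : AEStronglyMeasurable H μ)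
    (hH2 : Integrable (fun x => H x ^ 2) μ) (hgH : ∀ᵐ x ∂μ, HasGradBound g x (H x)) :
    ∫ x, g x * Real.exp (g x) ∂μ
      - (∫ x, Real.exp (g x) ∂μ) * Real.log (∫ x, Real.exp (g x) ∂μ)
      ≤ c / 2 * ∫ x, H x ^ 2 * Real.exp (g x) ∂μ := by
  have hgm : Measurable g := hg.continuous.measurable
  have hsq : ∀ s : ℝ, Real.exp (s / 2) ^ 2 = Real.exp s := fun s => by
    rw [← Real.exp_nat_mul]; congr 1; push_cast; ring
  have hexp : ∀ x, |Real.exp (g x / 2)| ≤ Real.exp (C / 2) := fun x => by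
    rw [Real.abs_exp]
    exact Real.exp_le_exp.2 (by linarith [(abs_le.1 (hC x)).2])
  have hL : LocLip fun x => Real.exp (g x / 2) :=
    hg.comp_contDiff hC (Φ := fun s => Real.exp (s / 2)) (by fun_prop)
  have hsqH : ∀ x, (Real.exp (g x / 2) / 2 * H x) ^ 2 = 1 / 4 * (H x ^ 2 * Real.exp (g x)) := by
    intro x
    rw [mul_pow, div_pow, hsq]
    ring
  have hint : Integrable (fun x => H x ^ 2 * Real.exp (g x)) μ := by
    refine hH2.mul_bdd (c := Real.exp C) (by fun_prop) (Eventually.of_forall fun x => ?_)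
    rw [Real.norm_eq_abs, Real.abs_exp]
    exact Real.exp_le_exp.2 (abs_le.1 (hC x)).2
  have h := hLSI.entropy_sq_le (H := fun x => Real.exp (g x / 2) / 2 * H x) hc hL hexp
    (fun x => mul_nonneg (by positivity) (hH0 x))
    ((by fun_prop : Measurable fun x => Real.exp (g x / 2) / 2).aestronglyMeasurable.mul hHm)
    (by simp only [hsqH]; exact hint.const_mul _)
    (by
      filter_upwards [hgH] with x hx
      have hd : HasDerivAt (fun s : ℝ => Real.exp (s / 2)) (Real.exp (g x / 2) / 2) (g x) := by
        simpa [div_eq_mul_inv] using ((hasDerivAt_id (g x)).div_const 2).exp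
      have h1 := hx.comp hd
      rwa [abs_of_nonneg (by positivity)] at h1)
  simp only [entropy, hsq, hsqH, Real.log_exp, integral_const_mul] at h
  simp only [mul_comm (g _)]
  linarith

/-- If `|∇g| ≤ H`, the entropy of `e^{t g}` is at most
`(t² / 2) ∫ c H² e^{t g} ≤ (t² / 2) (Ent (e^{t g}) + ∫ e^{t g} · log ∫ e^{c H²})`,
and absorbing the entropy on the right bounds the derivative of `t ↦ log (∫ e^{t g}) / t`. -/
lemma LogSobolev.integral_exp_le (hLSI : LogSobolev μ c) (hc : 0 ≤ c) (hg : LocLip g)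
    (hC : ∀ x, |g x| ≤ C) (hH0 : ∀ x, 0 ≤ H x) (hHm : AEStronglyMeasurable H μ)
    (hH2 : Integrable (fun x => H x ^ 2) μ) (hgH : ∀ᵐ x ∂μ, HasGradBound g x (H x))
    (hexp : Integrable (fun x => Real.exp (c * H x ^ 2)) μ) :
    ∫ x, Real.exp (g x) ∂μ ≤ Real.exp (∫ x, g x ∂μ) * ∫ x, Real.exp (c * H x ^ 2) ∂μ := by
  have hgm : Measurable g := hg.continuous.measurable
  set β := ∫ x, Real.exp (c * H x ^ 2) ∂μ with hβ
  have hβ1 : 1 ≤ β := by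
    have := integral_mono (integrable_const 1) hexp
      fun x => Real.one_le_exp (mul_nonneg hc (sq_nonneg (H x)))
    simpa using this
  have hlogβ : 0 ≤ Real.log β := Real.log_nonneg hβ1
  have key := cgf_le_of_differential_inequality (μ := μ) hgm hC (a := 0) (b := Real.log β)
    one_pos (by
      intro t ht ht1
      have htC : ∀ x, |t * g x| ≤ t * C := fun x => by
        rw [abs_mul, abs_of_pos ht]
        exact mul_le_mul_of_nonneg_left (hC x) ht.le
      have hint : Integrable (fun x => H x ^ 2 * Real.exp (t * g x)) μ := by
        refine hH2.mul_bdd (c := Real.exp (t * C)) (by fun_prop) (Eventually.of_forall fun x => ?_)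
        rw [Real.norm_eq_abs, Real.abs_exp]
        exact Real.exp_le_exp.2 (abs_le.1 (htC x)).2
      have hZ0 : 0 < ∫ x, Real.exp (t * g x) ∂μ := integral_exp_pos
        (integrable_comp_of_bounded hgm hC (Real.continuous_exp.comp (continuous_const_mul t)))
      have h1 := hLSI.entropy_exp_le (g := fun x => t * g x) (H := fun x => t * H x) hc
        (hg.const_mul t) htC (fun x => mul_nonneg ht.le (hH0 x)) (hHm.const_mul t)
        (by simp only [mul_pow]; exact hH2.const_mul _)
        (by
          filter_upwards [hgH] with x hx
          simpa [abs_of_pos ht] using hx.const_mul t)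
      have h2 := integral_mul_exp_le_entropy (μ := μ) (g := fun x => t * g x)
        (h := fun x => c * H x ^ 2) (hgm.const_mul t) htC
        (by simpa only [mul_assoc] using hint.const_mul c) hexp
      simp only [mul_pow, mul_assoc, integral_const_mul] at h1 h2
      rw [← hβ] at h2
      rw [ProbabilityTheory.cgf, ProbabilityTheory.mgf]
      set Z := ∫ x, Real.exp (t * g x) ∂μ
      set A := ∫ x, g x * Real.exp (t * g x) ∂μ
      set I := ∫ x, H x ^ 2 * Real.exp (t * g x) ∂μ
      have hE : t * A - Z * Real.log Z ≤ t ^ 2 * (Z * Real.log β) := by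
        have h3 : 0 ≤ Z * Real.log β := mul_nonneg hZ0.le hlogβ
        have h4 : t ^ 2 ≤ 1 := pow_le_one₀ ht.le ht1
        have h5 : t * A - Z * Real.log Z
            ≤ t ^ 2 / 2 * ((t * A - Z * Real.log Z) + Z * Real.log β) := by
          nlinarith [mul_le_mul_of_nonneg_left h2 (sq_nonneg t)]
        rcases le_total (t * A - Z * Real.log Z) 0 with h6 | h6
        · exact h6.trans (by positivity)
        · nlinarith
      have h7 : t * (1 - 0 * t) * (A / Z) - Real.log Z = (t * A - Z * Real.log Z) / Z := by
        field_simp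
        ring
      rw [h7, div_le_iff₀ hZ0]
      linarith)
  have hZ0 : 0 < ∫ x, Real.exp (g x) ∂μ :=
    integral_exp_pos (integrable_comp_of_bounded hgm hC Real.continuous_exp)
  simp only [ProbabilityTheory.cgf, ProbabilityTheory.mgf, one_mul, sub_zero, div_one,
    mul_one] at key
  calc ∫ x, Real.exp (g x) ∂μ = Real.exp (Real.log (∫ x, Real.exp (g x) ∂μ)) :=
        (Real.exp_log hZ0).symm
    _ ≤ Real.exp (∫ x, g x ∂μ + Real.log β) := Real.exp_le_exp.2 (by linarith)
    _ = _ := by rw [Real.exp_add, Real.exp_log (by linarith)]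

/-- For `|∇g| ≤ 1`, the entropy of `e^{t g²}` is at most `2 c t² ∫ g² e^{t g²}`, which makes
`(1 - 2 c t) log (∫ e^{t g²}) / t` nonincreasing; here `t = 1 / (4 c)`. -/
lemma LogSobolev.integral_exp_sq_le_of_bounded (hLSI : LogSobolev μ c) (hc : 0 < c)
    (hg : LocLip g) (hC : ∀ x, |g x| ≤ C) (hg1 : ∀ᵐ x ∂μ, HasGradBound g x 1) :
    ∫ x, Real.exp (1 / (4 * c) * g x ^ 2) ∂μ ≤ Real.exp (1 / (2 * c) * ∫ x, g x ^ 2 ∂μ) := by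
  have hgm : Measurable g := hg.continuous.measurable
  have hsqm : Measurable fun x => g x ^ 2 := by fun_prop
  have hsqC : ∀ x, |g x ^ 2| ≤ C ^ 2 := fun x => by
    rw [abs_pow]; exact pow_le_pow_left₀ (abs_nonneg _) (hC x) 2
  have hexpint : ∀ t : ℝ, Integrable (fun x => Real.exp (t * g x ^ 2)) μ := fun t =>
    integrable_comp_of_bounded hgm hC (Φ := fun s => Real.exp (t * s ^ 2)) (by fun_prop)
  have key := cgf_le_of_differential_inequality (μ := μ) hsqm hsqC (a := 2 * c) (b := 0)
    (T := 1 / (4 * c)) (by positivity) (by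
      intro t ht _
      have htC : ∀ x, |t * g x ^ 2| ≤ t * C ^ 2 := fun x => by
        rw [abs_mul, abs_of_pos ht]
        exact mul_le_mul_of_nonneg_left (hsqC x) ht.le
      have hZ0 : 0 < ∫ x, Real.exp (t * g x ^ 2) ∂μ := integral_exp_pos (hexpint t)
      have h1 := hLSI.entropy_exp_le (g := fun x => t * g x ^ 2) (H := fun x => |t * (2 * g x)|)
        hc.le (hg.comp_contDiff hC (Φ := fun s => t * s ^ 2) (by fun_prop)) htC
        (fun x => abs_nonneg _) (by fun_prop)
        (integrable_comp_of_bounded hgm hC (Φ := fun s => |t * (2 * s)| ^ 2) (by fun_prop))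
        (by
          filter_upwards [hg1] with x hx
          have hd : HasDerivAt (fun s : ℝ => t * s ^ 2) (t * (2 * g x)) (g x) := by
            simpa using ((hasDerivAt_id (g x)).pow 2).const_mul t
          simpa using hx.comp hd)
      have hH : ∀ x, |t * (2 * g x)| ^ 2 * Real.exp (t * g x ^ 2)
          = 4 * t ^ 2 * (g x ^ 2 * Real.exp (t * g x ^ 2)) := fun x => by
        rw [sq_abs]; ring
      simp only [hH, integral_const_mul, mul_assoc t] at h1
      rw [ProbabilityTheory.cgf, ProbabilityTheory.mgf]
      set Z := ∫ x, Real.exp (t * g x ^ 2) ∂μ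
      set A := ∫ x, g x ^ 2 * Real.exp (t * g x ^ 2) ∂μ
      have h7 : t * (1 - 2 * c * t) * (A / Z) - Real.log Z
          = (t * A - Z * Real.log Z - 2 * c * t ^ 2 * A) / Z := by
        field_simp
        ring
      rw [h7, div_le_iff₀ hZ0]
      linarith)
  have hZ0 := integral_exp_pos (hexpint (1 / (4 * c)))
  rw [ProbabilityTheory.cgf, ProbabilityTheory.mgf] at key
  calc ∫ x, Real.exp (1 / (4 * c) * g x ^ 2) ∂μ
      = Real.exp (Real.log (∫ x, Real.exp (1 / (4 * c) * g x ^ 2) ∂μ)) :=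
        (Real.exp_log hZ0).symm
    _ ≤ _ := Real.exp_le_exp.2 ?_
  set Λ := Real.log (∫ x, Real.exp (1 / (4 * c) * g x ^ 2) ∂μ)
  have h8 : (1 - 2 * c * (1 / (4 * c))) * (Λ / (1 / (4 * c))) - 0 * (1 / (4 * c))
      = 2 * c * Λ := by
    field_simp
    ring
  rw [h8] at key
  rw [one_div, ← div_eq_inv_mul, le_div_iff₀ (by positivity)]
  linarith

/-- A nonnegative locally Lipschitz function with `|∇u| ≤ 1` is square integrable: the means of its
truncations `uₙ` are bounded since `exp (∫ uₙ) ≤ e^c / ∫ e^{-uₙ} ≤ e^c / ∫ e^{-u}`, and therefore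
so are the integrals `∫ e^{uₙ}`. -/
lemma LogSobolev.integrable_sq (hLSI : LogSobolev μ c) (hc : 0 ≤ c) {u : M → ℝ} (hu : LocLip u)
    (hu0 : ∀ x, 0 ≤ u x) (hu1 : ∀ᵐ x ∂μ, HasGradBound u x 1) :
    Integrable (fun x => u x ^ 2) μ := by
  have hum : Measurable u := hu.continuous.measurable
  have hvL : ∀ n, LocLip fun x => trunc n (u x) := fun n => hu.comp_lipschitz (lipschitzWith_trunc n)
  have hvC : ∀ n x, |trunc n (u x)| ≤ n := fun n x => abs_trunc_le_nat n _
  have hv1 : ∀ n, ∀ᵐ x ∂μ, HasGradBound (fun x => trunc n (u x)) x 1 := fun n => by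
    filter_upwards [hu1] with x hx using hx.comp_lipschitz (lipschitzWith_trunc n)
  have hvint : ∀ n, ∀ s : ℝ, Integrable (fun x => Real.exp (s * trunc n (u x))) μ := fun n s =>
    integrable_comp_of_bounded (hvL n).continuous.measurable (hvC n)
      (Φ := fun r => Real.exp (s * r)) (by fun_prop)
  have hconc : ∀ n, ∀ s : ℝ, |s| = 1 → ∫ x, Real.exp (s * trunc n (u x)) ∂μ
      ≤ Real.exp (s * ∫ x, trunc n (u x) ∂μ) * Real.exp c := by
    intro n s hs
    have h := hLSI.integral_exp_le (H := fun _ => 1) (C := n) hc ((hvL n).const_mul s)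
      (fun x => by rw [abs_mul, hs, one_mul]; exact hvC n x) (fun _ => zero_le_one) (by fun_prop)
      (by simp) (by
        filter_upwards [hv1 n] with x hx
        simpa [hs] using hx.const_mul s) (integrable_const _)
    simpa [integral_const_mul] using h
  have hneg : Integrable (fun x => Real.exp (-u x)) μ :=
    Integrable.of_bound (by fun_prop) 1 (Eventually.of_forall fun x => by
      rw [Real.norm_eq_abs, Real.abs_exp]
      exact Real.exp_le_one_iff.2 (by linarith [hu0 x]))
  have hδ : 0 < ∫ x, Real.exp (-u x) ∂μ := integral_exp_pos hneg
  have hbound : ∀ n, ∫ x, Real.exp (1 * trunc n (u x)) ∂μ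
      ≤ Real.exp c / (∫ x, Real.exp (-u x) ∂μ) * Real.exp c := by
    intro n
    refine (hconc n 1 abs_one).trans (mul_le_mul_of_nonneg_right ?_ (Real.exp_pos c).le)
    have h1 : ∫ x, Real.exp (-u x) ∂μ ≤ ∫ x, Real.exp (-1 * trunc n (u x)) ∂μ := by
      refine integral_mono hneg (hvint n (-1)) fun x => Real.exp_le_exp.2 ?_
      have := (le_abs_self _).trans (abs_trunc_le n (u x))
      rw [abs_of_nonneg (hu0 x)] at this
      linarith
    have h2 := h1.trans (hconc n (-1) (by simp))
    rw [neg_one_mul, Real.exp_neg, inv_mul_eq_div, le_div_iff₀ (Real.exp_pos _)] at h2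
    rw [one_mul, le_div_iff₀ hδ]
    linarith
  have hexp := (integrable_and_integral_le_of_tendsto (fun n => hvint n 1)
    (fun n x => (Real.exp_pos _).le)
    (fun x => (Real.continuous_exp.tendsto _).comp ((tendsto_trunc (u x)).const_mul 1))
    hbound tendsto_const_nhds).1
  refine (hexp.const_mul 2).mono' (by fun_prop) (Eventually.of_forall fun x => ?_)
  have h3 := Real.quadratic_le_exp_of_nonneg (hu0 x)
  rw [Real.norm_eq_abs, abs_of_nonneg (sq_nonneg _), one_mul]
  nlinarith [hu0 x]

lemma LogSobolev.integral_exp_sq_le (hLSI : LogSobolev μ c) (hc : 0 < c) {u : M → ℝ}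
    (hu : LocLip u) (hu0 : ∀ x, 0 ≤ u x) (hu1 : ∀ᵐ x ∂μ, HasGradBound u x 1) :
    Integrable (fun x => Real.exp (1 / (4 * c) * u x ^ 2)) μ ∧
      ∫ x, Real.exp (1 / (4 * c) * u x ^ 2) ∂μ ≤ Real.exp (1 / (2 * c) * ∫ x, u x ^ 2 ∂μ) := by
  have hu2 := hLSI.integrable_sq hc.le hu hu0 hu1
  have hvL : ∀ n, LocLip fun x => trunc n (u x) := fun n => hu.comp_lipschitz (lipschitzWith_trunc n)
  have hvC : ∀ n x, |trunc n (u x)| ≤ n := fun n x => abs_trunc_le_nat n _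
  refine integrable_and_integral_le_of_tendsto
    (F := fun n x => Real.exp (1 / (4 * c) * trunc n (u x) ^ 2))
    (fun n => integrable_comp_of_bounded (hvL n).continuous.measurable (hvC n)
      (Φ := fun s => Real.exp (1 / (4 * c) * s ^ 2)) (by fun_prop))
    (fun n x => (Real.exp_pos _).le)
    (fun x => (Real.continuous_exp.tendsto _).comp (((tendsto_trunc (u x)).pow 2).const_mul _))
    (fun n => ?_) tendsto_const_nhds
  refine (hLSI.integral_exp_sq_le_of_bounded hc (hvL n) (hvC n) ?_).trans (Real.exp_le_exp.2 ?_)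
  · filter_upwards [hu1] with x hx using hx.comp_lipschitz (lipschitzWith_trunc n)
  · refine mul_le_mul_of_nonneg_left ?_ (by positivity)
    refine integral_mono (integrable_comp_of_bounded (hvL n).continuous.measurable (hvC n)
      (continuous_pow 2)) hu2 fun x => ?_
    exact sq_le_sq.2 (abs_trunc_le n (u x))

end LogSobolev

end MetricLSI

/-! ### Second order concentration -/

theorem proposition2p1 {M : Type*} [MetricSpace M] [MeasurableSpace M] [BorelSpace M]
    (μ : Measure M) [IsProbabilityMeasure μ]
    (hsupp : μ μ.supportᶜ = 0)
    (σ : ℝ) (hσ : 0 < σ)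
    (hLSI : MetricLSI.LogSobolev μ (σ ^ 2))
    (f : M → ℝ) (hf : MetricLSI.LocLip f)
    (hfint : Integrable f μ) (hmean : ∫ x, f x ∂μ = 0)
    (hgrad : MetricLSI.LocLip (MetricLSI.gradModulus f))
    (hsecond : ∀ x ∈ μ.support, MetricLSI.secondOrderModulus f x ≤ 1) :
    Integrable (fun x => Real.exp (1 / (2 * σ ^ 2) * f x)) μ ∧
    Integrable (fun x => MetricLSI.gradModulus f x ^ 2) μ ∧
    ∫ x, Real.exp (1 / (2 * σ ^ 2) * f x) ∂μ ≤
      Real.exp (1 / (2 * σ ^ 2) * ∫ x, MetricLSI.gradModulus f x ^ 2 ∂μ) := by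
  have hc : 0 < σ ^ 2 := by positivity
  generalize σ ^ 2 = c at *
  set u := MetricLSI.gradModulus f
  have hu0 : ∀ x, 0 ≤ u x := fun x => ENNReal.toReal_nonneg
  have hum : Measurable u := hgrad.continuous.measurable
  have hu1 : ∀ᵐ x ∂μ, MetricLSI.HasGradBound u x 1 := by
    have hae : ∀ᵐ x ∂μ, x ∈ μ.support := hsupp
    filter_upwards [hae] with x hx
    exact MetricLSI.hasGradBound_of_eGradModulus_le zero_le_one (by
      rw [ENNReal.ofReal_one]; exact hsecond x hx)
  have hu2 := hLSI.integrable_sq hc.le hgrad hu0 hu1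
  obtain ⟨hexp, hexp_le⟩ := hLSI.integral_exp_sq_le hc hgrad hu0 hu1
  have hd : 0 < 1 / (2 * c) := by positivity
  have hsq : ∀ x, c * (1 / (2 * c) * u x) ^ 2 = 1 / (4 * c) * u x ^ 2 := fun x => by
    field_simp
    ring
  have hgL : ∀ n, MetricLSI.LocLip fun x => MetricLSI.trunc n (f x) := fun n =>
    hf.comp_lipschitz (MetricLSI.lipschitzWith_trunc n)
  have hgC : ∀ n x, |MetricLSI.trunc n (f x)| ≤ n := fun n x => MetricLSI.abs_trunc_le_nat n _
  have hmeans : Tendsto (fun n => ∫ x, MetricLSI.trunc n (f x) ∂μ) atTop (𝓝 0) := by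
    rw [← hmean]
    exact tendsto_integral_of_dominated_convergence (fun x => |f x|)
      (fun n => (hgL n).continuous.measurable.aestronglyMeasurable) hfint.abs
      (fun n => Eventually.of_forall fun x => MetricLSI.abs_trunc_le n (f x))
      (Eventually.of_forall fun x => MetricLSI.tendsto_trunc (f x))
  -- The truncations of `f / (2c)` have gradient at most `u / (2c)`, and `c (u / (2c))² = u² / (4c)`.
  have hstep : ∀ n : ℕ, ∫ x, Real.exp (1 / (2 * c) * MetricLSI.trunc n (f x)) ∂μ
      ≤ Real.exp (1 / (2 * c) * ∫ x, MetricLSI.trunc n (f x) ∂μ)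
        * Real.exp (1 / (2 * c) * ∫ x, u x ^ 2 ∂μ) := by
    intro n
    have h := hLSI.integral_exp_le (g := fun x => 1 / (2 * c) * MetricLSI.trunc n (f x))
      (H := fun x => 1 / (2 * c) * u x) (C := 1 / (2 * c) * n) hc.le ((hgL n).const_mul _)
      (fun x => by
        rw [abs_mul, abs_of_pos hd]
        exact mul_le_mul_of_nonneg_left (hgC n x) hd.le)
      (fun x => mul_nonneg hd.le (hu0 x)) (by fun_prop)
      (by simp only [mul_pow]; exact hu2.const_mul _)
      (Eventually.of_forall fun x => by
        have h1 := ((hf.hasGradBound x).comp_lipschitz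
          (MetricLSI.lipschitzWith_trunc n)).const_mul (1 / (2 * c))
        rwa [abs_of_pos hd] at h1)
      (by simpa only [hsq] using hexp)
    simp only [hsq, integral_const_mul] at h
    exact h.trans (mul_le_mul_of_nonneg_left hexp_le (Real.exp_pos _).le)
  have hlim := MetricLSI.integrable_and_integral_le_of_tendsto
    (fun n => MetricLSI.integrable_comp_of_bounded (μ := μ) (hgL n).continuous.measurable (hgC n)
      (Φ := fun s => Real.exp (1 / (2 * c) * s)) (by fun_prop))
    (fun n x => (Real.exp_pos _).le)
    (fun x => (Real.continuous_exp.tendsto _).comp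
      ((MetricLSI.tendsto_trunc (f x)).const_mul (1 / (2 * c))))
    hstep (((Real.continuous_exp.tendsto _).comp (hmeans.const_mul (1 / (2 * c)))).mul_const _)
  rw [mul_zero, Real.exp_zero, one_mul] at hlim
  exact ⟨hlim.1, hu2, hlim.2⟩
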